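/- Let $K$ be a perfect field and let $A$ be a finite-dimensional (left) Leibniz algebra over $K$, that is, a finite-dimensional $K$-vector space with a bilinear product satisfying $x(yz)=(xy)z+y(xz)$ for all $x,y,z\in A$. For a Leibniz algebra $S$, let $F(S)$ be the intersection of all maximal (proper) subalgebras of $S$ (with $F(S)=S$ if there are none), and let the Frattini ideal $\Phi(S)$ be the largest two-sided ideal of $S$ contained in $F(S)$. Suppose that $A$ is solvable (the series $A^{(0)}=A$, $A^{(n+1)}=A^{(n)}A^{(n)}$ reaches $0$, where the product of two subspaces is the span of all products of their elements) and elementary (i.e. $\Phi(S)=0$ for every subalgebra $S$ of $A$). Then the algebra $A^2=AA$ is nilpotent: with $N=A^2$, $N^1=N$ and $N^{n+1}=N\,N^{n}$, one has $N^{n}=0$ for some $n\ge 1$. -/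

import Mathlib

/-!
Left Leibniz algebras over a field `K`: a not necessarily associative `K`-algebra is a
`NonUnitalNonAssocRing A` with `Module K A`, `IsScalarTower K A A` and `SMulCommClass K A A`
(the product is `K`-bilinear).  Subalgebras are terms of `NonUnitalSubalgebra K A`.
-/

namespace Leibniz

/-- The (left) Leibniz identity `x(yz) = (xy)z + y(xz)`: left multiplications are derivations. -/
class IsLeibniz (A : Type*) [NonUnitalNonAssocRing A] : Prop where
  leibniz : ∀ x y z : A, x * (y * z) = (x * y) * z + y * (x * z)

section

variable (K : Type*) (A : Type*) [Field K] [NonUnitalNonAssocRing A] [Module K A]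
  [IsScalarTower K A A] [SMulCommClass K A A]

/-- The product `I J` of two subspaces: the span of all products `x * y`, `x ∈ I`, `y ∈ J`. -/
def subspaceMul {K A : Type*} [Field K] [NonUnitalNonAssocRing A] [Module K A]
    [IsScalarTower K A A] [SMulCommClass K A A] (I J : Submodule K A) : Submodule K A :=
  Submodule.map₂ (LinearMap.mul K A) I J

/-- `derivedSeries K A n` is `A⁽ⁿ⁾`: `A⁽⁰⁾ = A` and `A⁽ⁿ⁺¹⁾ = A⁽ⁿ⁾ A⁽ⁿ⁾`. -/
def derivedSeries : ℕ → Submodule K A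
  | 0 => ⊤
  | n + 1 => subspaceMul (derivedSeries n) (derivedSeries n)

/-- `A` is solvable: its derived series reaches `0`. -/
def IsSolvable : Prop := ∃ n, derivedSeries K A n = ⊥

/-- `lowerCentralSeries K A n` is the power `Aⁿ⁺¹`, where `A¹ = A` and `Aⁿ⁺¹ = A Aⁿ`. -/
def lowerCentralSeries : ℕ → Submodule K A
  | 0 => ⊤
  | n + 1 => subspaceMul ⊤ (lowerCentralSeries n)

/-- `A` is nilpotent: some power `Aⁿ⁺¹` is `0`. -/
def IsNilpotent : Prop := ∃ n, lowerCentralSeries K A n = ⊥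

/-- `A² = A A`, the span of all products, as a subalgebra of `A`. -/
def square : NonUnitalSubalgebra K A :=
  { subspaceMul (⊤ : Submodule K A) ⊤ with
    mul_mem' := fun {a b} _ _ =>
      Submodule.apply_mem_map₂ (LinearMap.mul K A) (Submodule.mem_top (x := a))
        (Submodule.mem_top (x := b)) }

/-- The Frattini subalgebra `F(A)`: the intersection of all maximal (proper) subalgebras of `A`
(it is `A` itself if there are none). -/
def frattiniSubalgebra : NonUnitalSubalgebra K A :=
  sInf {M : NonUnitalSubalgebra K A | IsCoatom M}

variable {K A} in
/-- A subspace is a (two-sided) ideal: `A I ⊆ I` and `I A ⊆ I`. -/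
def IsIdeal (I : Submodule K A) : Prop :=
  ∀ a : A, ∀ x ∈ I, a * x ∈ I ∧ x * a ∈ I

/-- The Frattini ideal `Φ(A)`: the largest ideal of `A` contained in `F(A)`, constructed as the
sum of all of them; see `isGreatest_frattiniIdeal`. -/
def frattiniIdeal : Submodule K A :=
  sSup {I : Submodule K A | IsIdeal I ∧ I ≤ (frattiniSubalgebra K A).toSubmodule}

theorem isIdeal_sSup {K A : Type*} [Field K] [NonUnitalNonAssocRing A] [Module K A]
    [IsScalarTower K A A] [SMulCommClass K A A] (s : Set (Submodule K A))
    (hs : ∀ I ∈ s, IsIdeal I) : IsIdeal (sSup s) := by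
  intro a x hx
  have h1 : sSup s ≤ (sSup s).comap (LinearMap.mulLeft K a) :=
    sSup_le fun I hI y hy => (le_sSup hI : I ≤ sSup s) (hs I hI a y hy).1
  have h2 : sSup s ≤ (sSup s).comap (LinearMap.mulRight K a) :=
    sSup_le fun I hI y hy => (le_sSup hI : I ≤ sSup s) (hs I hI a y hy).2
  exact ⟨h1 hx, h2 hx⟩

theorem isGreatest_frattiniIdeal :
    IsGreatest {I : Submodule K A | IsIdeal I ∧ I ≤ (frattiniSubalgebra K A).toSubmodule}
      (frattiniIdeal K A) :=
  ⟨⟨isIdeal_sSup _ fun _ hI => hI.1, sSup_le fun _ hI => hI.2⟩, fun _ hI => le_sSup hI⟩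

/-- `A` is elementary: the Frattini ideal of every subalgebra `S` of `A` (formed inside the
algebra `S`) is `0`. -/
def IsElementary : Prop :=
  ∀ S : NonUnitalSubalgebra K A, frattiniIdeal K S = ⊥

end

end Leibniz

/-!
In an elementary algebra every ideal `W` of a subalgebra `S` has a complementary subalgebra: if
`D` is minimal among the subalgebras with `W + D = S`, then `W ∩ D` is an ideal of `D` lying in
every maximal subalgebra of `D`, hence in `Φ(D) = 0` (`exists_isCompl_subalgebra`).

Let `C` be a subspace with `C C = 0`, and let `y` satisfy `y y = 0`, `y C ⊆ C`, `C y ⊆ C`. Applied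
to `C + K y`, this makes `C` completely reducible under left and right multiplication by `y`
(`eq_zero_of_mul_self_eq_zero`), so the left multiplication has a squarefree minimal polynomial
(`squarefree_minpoly_mulLeft`), which is separable because `K` is perfect. A separable
endomorphism `T` cannot have a nonzero commutator `[X, T]` that commutes with `T`, because
`0 = [X, f(T)] = f'(T) [X, T]` for the minimal polynomial `f`, and `f'(T)` is invertible
(`commutator_eq_zero_of_separable`).

These facts show that a subalgebra `S` with `S⁽³⁾ = 0` has `S⁽²⁾ = 0` (`second_derived_eq_bot`).
Write `S = C ⊕ D` with `C = S⁽²⁾`, and `D = M ⊕ E` with `M = D D`; then `M M = 0` and `E E = 0`,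
and so `M` is spanned by `E M` and `M E`. For `x ∈ D` and `y ∈ M` the left multiplication by
`x y` on `C` is the commutator of those by `x` and `y`, and it commutes with that by `y`; so it is
zero, and `M C = 0` follows. Then right multiplication by `y` on `C` has square zero, so it
vanishes too, and `C = (C + M)(C + M) = 0`. Descending along the derived series of a solvable
elementary `A` gives `A⁽²⁾ = 0`: the algebra `A²` is even abelian.
-/

namespace Leibniz

/-! ### Products of subspaces and sums with ideals -/

section Products

variable {K A : Type*} [Field K] [NonUnitalNonAssocRing A] [Module K A]
  [IsScalarTower K A A] [SMulCommClass K A A]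

theorem mul_mem_subspaceMul {I J : Submodule K A} {x y : A} (hx : x ∈ I) (hy : y ∈ J) :
    x * y ∈ subspaceMul I J :=
  Submodule.apply_mem_map₂ (LinearMap.mul K A) hx hy

theorem subspaceMul_le {I J L : Submodule K A} :
    subspaceMul I J ≤ L ↔ ∀ x ∈ I, ∀ y ∈ J, x * y ∈ L :=
  Submodule.map₂_le

theorem subspaceMul_mono {I J I' J' : Submodule K A} (h : I ≤ I') (h' : J ≤ J') :
    subspaceMul I J ≤ subspaceMul I' J' :=
  Submodule.map₂_le_map₂ h h'

/-- The product `P P` is stable under multiplication on both sides by every element that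
stabilizes `P`. -/
theorem IsLeibniz.mul_mem_subspaceMul_self [IsLeibniz A] {P : Submodule K A} {s : A}
    (hl : ∀ p ∈ P, s * p ∈ P) (hr : ∀ p ∈ P, p * s ∈ P) :
    ∀ c ∈ subspaceMul P P, s * c ∈ subspaceMul P P ∧ c * s ∈ subspaceMul P P := by
  have h1 : subspaceMul P P ≤ (subspaceMul P P).comap (LinearMap.mulLeft K s) := by
    refine subspaceMul_le.2 fun p hp q hq => ?_
    change s * (p * q) ∈ subspaceMul P P
    rw [IsLeibniz.leibniz]
    exact add_mem (mul_mem_subspaceMul (hl p hp) hq) (mul_mem_subspaceMul hp (hl q hq))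
  have h2 : subspaceMul P P ≤ (subspaceMul P P).comap (LinearMap.mulRight K s) := by
    refine subspaceMul_le.2 fun p hp q hq => ?_
    change p * q * s ∈ subspaceMul P P
    rw [eq_sub_of_add_eq (IsLeibniz.leibniz p q s).symm]
    exact sub_mem (mul_mem_subspaceMul hp (hr q hq)) (mul_mem_subspaceMul hq (hr p hp))
  exact fun c hc => ⟨h1 hc, h2 hc⟩

/-- The subalgebra `W + M`, for a subalgebra `M` and a multiplicatively closed subspace `W`
that is stable under multiplication by `M` on both sides. -/
def supSubalgebra (W : Submodule K A) (M : NonUnitalSubalgebra K A)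
    (hW : ∀ w ∈ W, ∀ w' ∈ W, w * w' ∈ W) (hM : ∀ m ∈ M, ∀ w ∈ W, m * w ∈ W ∧ w * m ∈ W) :
    NonUnitalSubalgebra K A :=
  { W ⊔ M.toSubmodule with
    mul_mem' := by
      intro a b ha hb
      obtain ⟨w, hw, m, hm, rfl⟩ := Submodule.mem_sup.1 ha
      obtain ⟨w', hw', m', hm', rfl⟩ := Submodule.mem_sup.1 hb
      have h : (w + m) * (w' + m') = (w * w' + w * m' + m * w') + m * m' := by
        rw [add_mul, mul_add, mul_add]; abel
      change (w + m) * (w' + m') ∈ W ⊔ M.toSubmodule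
      rw [h]
      exact Submodule.add_mem_sup
        (add_mem (add_mem (hW w hw w' hw') (hM m' hm' w hw).2) (hM m hm w' hw').1)
        (M.mul_mem hm hm') }

omit [IsScalarTower K A A] [SMulCommClass K A A] in
theorem mem_supSubalgebra {W : Submodule K A} {M : NonUnitalSubalgebra K A}
    {hW : ∀ w ∈ W, ∀ w' ∈ W, w * w' ∈ W} {hM : ∀ m ∈ M, ∀ w ∈ W, m * w ∈ W ∧ w * m ∈ W}
    {a : A} : a ∈ supSubalgebra W M hW hM ↔ a ∈ W ⊔ M.toSubmodule :=
  Iff.rfl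

end Products

/-! ### Complements of ideals in elementary algebras -/

section Complements

variable {K A : Type*} [Field K] [NonUnitalNonAssocRing A] [Module K A]
  [IsScalarTower K A A] [SMulCommClass K A A]

/-- If `J` is an ideal that is not contained in the Frattini subalgebra, then `J + M` is the whole
algebra for some maximal subalgebra `M`. -/
theorem IsIdeal.exists_sup_eq_top {J : Submodule K A} (hJ : IsIdeal J)
    (h : ¬ J ≤ (frattiniSubalgebra K A).toSubmodule) :
    ∃ M : NonUnitalSubalgebra K A, M ≠ ⊤ ∧ J ⊔ M.toSubmodule = ⊤ := by
  obtain ⟨x, hxJ, hx⟩ := SetLike.not_le_iff_exists.1 h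
  have hx' : ¬ ∀ M ∈ {M : NonUnitalSubalgebra K A | IsCoatom M}, x ∈ M := fun h' =>
    hx (NonUnitalAlgebra.mem_sInf.2 h')
  push Not at hx'
  obtain ⟨M, hM, hxM⟩ := hx'
  refine ⟨M, hM.1, ?_⟩
  have hlt : M < supSubalgebra J M (fun w _ w' hw' => (hJ w w' hw').1) (fun m _ => hJ m) := by
    refine lt_of_le_not_ge (fun m hm => mem_supSubalgebra.2 (Submodule.mem_sup_right hm))
      fun hle => hxM (hle (mem_supSubalgebra.2 (Submodule.mem_sup_left hxJ)))
  have htop := hM.2 _ hlt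
  rw [eq_top_iff]
  intro a _
  exact mem_supSubalgebra.1 (htop ▸ NonUnitalAlgebra.mem_top)

theorem exists_isCompl_subalgebra [FiniteDimensional K A] (helem : IsElementary K A)
    (S : NonUnitalSubalgebra K A) (W : Submodule K A) (hWS : W ≤ S.toSubmodule)
    (hW : ∀ s ∈ S, ∀ w ∈ W, s * w ∈ W ∧ w * s ∈ W) :
    ∃ E : NonUnitalSubalgebra K A, E ≤ S ∧ W ⊔ E.toSubmodule = S.toSubmodule ∧
      W ⊓ E.toSubmodule = ⊥ := by
  let X : Set (NonUnitalSubalgebra K A) := {D | D ≤ S ∧ W ⊔ D.toSubmodule = S.toSubmodule}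
  have hX : X.Nonempty := ⟨S, le_rfl, sup_eq_right.2 hWS⟩
  -- A supplement of least dimension is minimal for inclusion.
  obtain ⟨D, ⟨hDS, hD⟩, hmin⟩ := (measure fun D : NonUnitalSubalgebra K A =>
    Module.finrank K D.toSubmodule).wf.has_min X hX
  refine ⟨D, hDS, hD, ?_⟩
  let J : Submodule K D := W.comap D.toSubmodule.subtype
  have hJ : IsIdeal J := fun d x hx => hW d (hDS d.2) x hx
  have hJF : J ≤ (frattiniSubalgebra K D).toSubmodule := by
    by_contra hcon
    obtain ⟨M, hM, hJM⟩ := hJ.exists_sup_eq_top hcon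
    let M' : NonUnitalSubalgebra K A := M.map (NonUnitalSubalgebraClass.subtype D)
    have hM'D : M' ≤ D := by
      rintro _ ⟨m, -, rfl⟩
      exact m.2
    have hDM : D.toSubmodule ≤ W ⊔ M'.toSubmodule := by
      intro d hd
      obtain ⟨j, hj, m, hm, hjm⟩ := Submodule.mem_sup.1
        (hJM ▸ Submodule.mem_top : (⟨d, hd⟩ : D) ∈ J ⊔ M.toSubmodule)
      have : d = (j : A) + m := (congrArg Subtype.val hjm).symm
      rw [this]
      exact Submodule.add_mem_sup hj ⟨m, hm, rfl⟩
    have hM'X : M' ∈ X := by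
      refine ⟨hM'D.trans hDS, le_antisymm (sup_le hWS (hM'D.trans hDS)) ?_⟩
      rw [← hD]
      exact sup_le le_sup_left hDM
    have hle : M'.toSubmodule ≤ D.toSubmodule := hM'D
    have heq : M'.toSubmodule = D.toSubmodule :=
      Submodule.eq_of_le_of_finrank_le hle (not_lt.1 (hmin M' hM'X))
    apply hM
    rw [eq_top_iff]
    intro d _
    have hd : (d : A) ∈ M'.toSubmodule := heq ▸ d.2
    obtain ⟨m, hm, hmd⟩ := hd
    rwa [← Subtype.ext hmd]
  have hJ0 : J = ⊥ := by
    rw [eq_bot_iff, ← helem D]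
    exact (isGreatest_frattiniIdeal K D).2 ⟨hJ, hJF⟩
  rw [eq_bot_iff]
  rintro x ⟨hxW, hxD⟩
  have hx : (⟨x, hxD⟩ : D) ∈ J := hxW
  rw [hJ0, Submodule.mem_bot] at hx
  exact (Submodule.mem_bot K).2 (congrArg Subtype.val hx)

end Complements

/-! ### Separable endomorphisms and commutators -/

section Separable

open Polynomial

variable {K R : Type*} [Field K] [Ring R] [Algebra K R]

/-- The commutator with `X` acts as a derivation on polynomials in `T`. -/
theorem commutator_aeval {X T : R} (h : Commute (X * T - T * X) T) (f : K[X]) :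
    X * aeval T f - aeval T f * X = aeval T (derivative f) * (X * T - T * X) := by
  induction f using Polynomial.induction_on with
  | C a => simp [Algebra.commutes a X]
  | add p q hp hq =>
    simp only [map_add, add_mul, mul_add, ← hp, ← hq]
    abel
  | monomial n a ih =>
    rw [pow_succ, ← mul_assoc]
    generalize C a * Polynomial.X ^ n = q at ih ⊢
    rw [derivative_mul, derivative_X, mul_one, map_add, map_mul, map_mul, aeval_X, add_mul,
      mul_assoc _ T (X * T - T * X), ← h.eq, ← mul_assoc _ (X * T - T * X) T, ← ih]
    noncomm_ring

theorem commutator_eq_zero_of_separable {X T : R} (h : Commute (X * T - T * X) T) {f : K[X]}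
    (hf : f.Separable) (hT : aeval T f = 0) : X * T - T * X = 0 := by
  have h1 := commutator_aeval h f
  rw [hT, mul_zero, zero_mul, sub_zero] at h1
  obtain ⟨a, b, hab⟩ := hf
  have h2 := congrArg (aeval T) hab
  rw [map_add, map_mul, map_mul, hT, mul_zero, zero_add, map_one] at h2
  rw [← one_mul (X * T - T * X), ← h2, mul_assoc, ← h1, mul_zero]

end Separable

/-! ### Complete reducibility of abelian subspaces -/

section Reducibility

variable {K A : Type*} [Field K] [NonUnitalNonAssocRing A] [Module K A]
  [IsScalarTower K A A] [SMulCommClass K A A] [FiniteDimensional K A]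

/-- Let `T` and `R` be left and right multiplication by `y` on `C`. An endomorphism of `C` with
square zero vanishes if it commutes with `T` and `R` and preserves every subspace stable under
both: its range has a complement stable under `T` and `R`. -/
theorem eq_zero_of_mul_self_eq_zero (helem : IsElementary K A) {C : Submodule K A} {y : A}
    (hCC : ∀ c ∈ C, ∀ c' ∈ C, c * c' = 0) (hyy : y * y = 0) {T R n : Module.End K C}
    (hT : ∀ c : C, (T c : A) = y * c) (hR : ∀ c : C, (R c : A) = c * y)
    (hnT : Commute n T) (hnR : Commute n R)
    (hn : ∀ U : Submodule K C, U ≤ U.comap T → U ≤ U.comap R → U ≤ U.comap n)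
    (hn2 : n * n = 0) : n = 0 := by
  let Y : NonUnitalSubalgebra K A :=
    { Submodule.span K {y} with
      mul_mem' := by
        intro a b ha hb
        obtain ⟨r, rfl⟩ := Submodule.mem_span_singleton.1 ha
        obtain ⟨s, rfl⟩ := Submodule.mem_span_singleton.1 hb
        rw [smul_mul_assoc, mul_smul_comm, hyy, smul_zero, smul_zero]
        exact zero_mem (Submodule.span K {y}) }
  have hyY : y ∈ Y := Submodule.mem_span_singleton_self y
  have hYC : ∀ m ∈ Y, ∀ c ∈ C, m * c ∈ C ∧ c * m ∈ C := by
    intro m hm c hc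
    obtain ⟨r, rfl⟩ := Submodule.mem_span_singleton.1 hm
    rw [smul_mul_assoc, mul_smul_comm]
    exact ⟨C.smul_mem r (hT ⟨c, hc⟩ ▸ (T ⟨c, hc⟩).2),
      C.smul_mem r (hR ⟨c, hc⟩ ▸ (R ⟨c, hc⟩).2)⟩
  let S := supSubalgebra C Y (fun c hc c' hc' => (hCC c hc c' hc').symm ▸ C.zero_mem) hYC
  have hCS : C ≤ S.toSubmodule := (le_sup_left : C ≤ C ⊔ Y.toSubmodule)
  have hyS : y ∈ S.toSubmodule := (le_sup_right : Y.toSubmodule ≤ C ⊔ Y.toSubmodule) hyY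
  let W : Submodule K A := (LinearMap.range n).map C.subtype
  have hWC : W ≤ C := Submodule.map_subtype_le C _
  have hW : ∀ s ∈ S, ∀ w ∈ W, s * w ∈ W ∧ w * s ∈ W := by
    rintro s hs _ ⟨_, ⟨c, rfl⟩, rfl⟩
    obtain ⟨c', hc', m, hm, rfl⟩ := Submodule.mem_sup.1 (mem_supSubalgebra.1 hs)
    obtain ⟨r, rfl⟩ := Submodule.mem_span_singleton.1 hm
    have h1 : C.subtype (n (T c)) = y * (n c : A) := by
      rw [← hT]; exact congrArg Subtype.val (LinearMap.congr_fun hnT c)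
    have h2 : C.subtype (n (R c)) = (n c : A) * y := by
      rw [← hR]; exact congrArg Subtype.val (LinearMap.congr_fun hnR c)
    rw [add_mul, mul_add, smul_mul_assoc, mul_smul_comm]
    simp only [Submodule.subtype_apply] at h1 h2 ⊢
    rw [hCC _ hc' _ (n c).2, hCC _ (n c).2 _ hc', zero_add, zero_add, ← h1, ← h2]
    exact ⟨W.smul_mem r ⟨_, ⟨_, rfl⟩, rfl⟩, W.smul_mem r ⟨_, ⟨_, rfl⟩, rfl⟩⟩
  obtain ⟨E, hES, hsup, hinf⟩ := exists_isCompl_subalgebra helem S W (hWC.trans hCS) hW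
  let U : Submodule K C := E.toSubmodule.comap C.subtype
  -- `C` kills `W`, so on `C` the element `y` acts as its component in `E`.
  obtain ⟨w, hw, e, he, hwe⟩ := Submodule.mem_sup.1 (hsup ▸ hyS)
  have hUT : U ≤ U.comap T := by
    intro u hu
    change (T u : A) ∈ E
    rw [hT, ← hwe, add_mul, hCC w (hWC hw) u u.2, zero_add]
    exact E.mul_mem he hu
  have hUR : U ≤ U.comap R := by
    intro u hu
    change (R u : A) ∈ E
    rw [hR, ← hwe, mul_add, hCC u u.2 w (hWC hw), zero_add]
    exact E.mul_mem hu he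
  ext c
  obtain ⟨w', hw', e', he', hc⟩ := Submodule.mem_sup.1 (hsup ▸ hCS c.2)
  obtain ⟨v, ⟨c', rfl⟩, hv⟩ := hw'
  have he'C : e' ∈ C := by
    rw [← eq_sub_iff_add_eq'] at hc
    rw [hc, ← hv]
    exact C.sub_mem c.2 (n c').2
  have hc2 : c = n c' + ⟨e', he'C⟩ := Subtype.ext (by rw [← hc, ← hv]; rfl)
  have hnc : n c = n ⟨e', he'C⟩ := by
    have h0 : n (n c') = 0 := LinearMap.congr_fun hn2 c'
    rw [hc2, map_add, h0, zero_add]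
  have hmem : (n ⟨e', he'C⟩ : A) ∈ W ⊓ E.toSubmodule :=
    ⟨⟨_, ⟨_, rfl⟩, rfl⟩, hn U hUT hUR (show (⟨e', he'C⟩ : C) ∈ U from he')⟩
  rw [hinf, Submodule.mem_bot] at hmem
  rw [hnc, hmem]
  rfl

open Polynomial in
theorem squarefree_minpoly_mulLeft (helem : IsElementary K A) {C : Submodule K A} {y : A}
    (hCC : ∀ c ∈ C, ∀ c' ∈ C, c * c' = 0) (hyy : y * y = 0) {T R : Module.End K C}
    (hT : ∀ c : C, (T c : A) = y * c) (hR : ∀ c : C, (R c : A) = c * y) (hTR : Commute T R) :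
    Squarefree (minpoly K T) := by
  rintro q ⟨g, hg⟩
  have hne : minpoly K T ≠ 0 := minpoly.ne_zero (Algebra.IsIntegral.isIntegral T)
  have h0 : aeval T (q * g) = 0 := by
    refine eq_zero_of_mul_self_eq_zero helem hCC hyy hT hR ?_ ?_ ?_ ?_
    · exact (Algebra.commute_of_mem_adjoin_singleton_of_commute
        (aeval_mem_adjoin_singleton K T) (Commute.refl T)).symm
    · exact (Algebra.commute_of_mem_adjoin_singleton_of_commute
        (aeval_mem_adjoin_singleton K T) hTR.symm).symm
    · intro U hU _ u hu
      exact aeval_apply_smul_mem_of_le_comap' hu (q * g) T hU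
    · rw [← map_mul, show q * g * (q * g) = minpoly K T * g by rw [hg]; ring, map_mul,
        minpoly.aeval, zero_mul]
  have hdvd : q * (q * g) ∣ 1 * (q * g) := by
    rw [one_mul, ← mul_assoc, ← hg]
    exact minpoly.dvd K T h0
  have hqg : q * g ≠ 0 := by
    intro h
    rw [mul_assoc, h, mul_zero] at hg
    exact hne hg
  exact isUnit_of_dvd_one ((mul_dvd_mul_iff_right hqg).1 hdvd)

end Reducibility

/-! ### The derived series of a solvable elementary algebra -/

section Derived

variable {K A : Type*} [Field K] [NonUnitalNonAssocRing A] [Module K A]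
  [IsScalarTower K A A] [SMulCommClass K A A] [FiniteDimensional K A] [IsLeibniz A]

omit [IsScalarTower K A A] [SMulCommClass K A A] [FiniteDimensional K A] in
theorem commute_mulLeft_mulRight {C : Submodule K A} {y : A} (hyy : y * y = 0)
    {T R : Module.End K C} (hT : ∀ c : C, (T c : A) = y * c) (hR : ∀ c : C, (R c : A) = c * y) :
    Commute T R := by
  ext c
  change (T (R c) : A) = R (T c)
  rw [hT, hR, hR, hT, IsLeibniz.leibniz, hyy, mul_zero, add_zero]

/-- Let `C` be an abelian subspace stable under left multiplication by `x` and under both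
multiplications by `y`, where `y y = 0` and `(x y) y = 0`. Then `x y` kills `C` from the left. -/
theorem mul_mul_eq_zero [PerfectField K] (helem : IsElementary K A) {C : Submodule K A} {x y : A}
    (hCC : ∀ c ∈ C, ∀ c' ∈ C, c * c' = 0) (hyy : y * y = 0) (hxyy : x * y * y = 0)
    (hx : ∀ c ∈ C, x * c ∈ C) (hy : ∀ c ∈ C, y * c ∈ C) (hy' : ∀ c ∈ C, c * y ∈ C) :
    ∀ c ∈ C, x * y * c = 0 := by
  let L : Module.End K C := (LinearMap.mulLeft K x).restrict hx
  let T : Module.End K C := (LinearMap.mulLeft K y).restrict hy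
  let R : Module.End K C := (LinearMap.mulRight K y).restrict hy'
  have hTR : Commute T R := commute_mulLeft_mulRight hyy (fun _ => rfl) (fun _ => rfl)
  have hZ : ∀ c : C, ((L * T - T * L) c : A) = x * y * c := by
    intro c
    change x * (y * (c : A)) - y * (x * c) = x * y * c
    rw [IsLeibniz.leibniz x y, add_sub_cancel_right]
  have hcomm : Commute (L * T - T * L) T := by
    ext c
    change ((L * T - T * L) (T c) : A) = y * ((L * T - T * L) c : A)
    rw [hZ, hZ]
    change x * y * (y * (c : A)) = _
    rw [IsLeibniz.leibniz (x * y) y, hxyy, zero_mul, zero_add]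
  have hsep : (minpoly K T).Separable := PerfectField.separable_iff_squarefree.2
    (squarefree_minpoly_mulLeft helem hCC hyy (fun _ => rfl) (fun _ => rfl) hTR)
  have h0 := commutator_eq_zero_of_separable hcomm hsep (minpoly.aeval K T)
  intro c hc
  rw [← hZ ⟨c, hc⟩, h0]
  rfl

theorem mulRight_eq_zero_of_mulLeft_eq_zero (helem : IsElementary K A) {C : Submodule K A} {y : A}
    (hCC : ∀ c ∈ C, ∀ c' ∈ C, c * c' = 0) (hyy : y * y = 0)
    (hy : ∀ c ∈ C, y * c = 0) (hy' : ∀ c ∈ C, c * y ∈ C) : ∀ c ∈ C, c * y = 0 := by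
  let R : Module.End K C := (LinearMap.mulRight K y).restrict hy'
  have hR : R = 0 := by
    refine eq_zero_of_mul_self_eq_zero (T := 0) (R := R) helem hCC hyy
      (fun c => (hy c c.2).symm) (fun _ => rfl) (Commute.zero_right R) (Commute.refl R)
      (fun U _ h => h) ?_
    ext c
    -- `0 = c (y y) = (c y) y + y (c y)`, and the last term vanishes because `y C = 0`.
    have h := IsLeibniz.leibniz (c : A) y y
    rw [hyy, mul_zero, hy _ (hy' c c.2), add_zero] at h
    exact h.symm
  intro c hc
  exact congrArg Subtype.val (LinearMap.congr_fun hR ⟨c, hc⟩)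

theorem second_derived_eq_bot [PerfectField K] (helem : IsElementary K A)
    (S : NonUnitalSubalgebra K A) {P C : Submodule K A}
    (hP : subspaceMul S.toSubmodule S.toSubmodule = P) (hC : subspaceMul P P = C)
    (hCC : subspaceMul C C = ⊥) : C = ⊥ := by
  have hmulCC : ∀ c ∈ C, ∀ c' ∈ C, c * c' = 0 := fun c hc c' hc' =>
    (Submodule.mem_bot K).1 (hCC ▸ mul_mem_subspaceMul hc hc')
  have hPS : P ≤ S.toSubmodule := by
    rw [← hP, subspaceMul_le]
    exact fun x hx y hy => S.mul_mem hx hy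
  have hCS : C ≤ S.toSubmodule := by
    rw [← hC, subspaceMul_le]
    exact fun x hx y hy => S.mul_mem (hPS hx) (hPS hy)
  have hSC : ∀ s ∈ S, ∀ c ∈ C, s * c ∈ C ∧ c * s ∈ C := by
    subst hP hC
    exact fun s hs => IsLeibniz.mul_mem_subspaceMul_self
      (fun p hp => mul_mem_subspaceMul hs (hPS hp)) (fun p hp => mul_mem_subspaceMul (hPS hp) hs)
  obtain ⟨D, hDS, hCD, hCD0⟩ := exists_isCompl_subalgebra helem S C hCS hSC
  obtain ⟨M, hM⟩ : ∃ M, subspaceMul D.toSubmodule D.toSubmodule = M := ⟨_, rfl⟩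
  have hMD : M ≤ D.toSubmodule := by
    rw [← hM, subspaceMul_le]
    exact fun x hx y hy => D.mul_mem hx hy
  have hMP : M ≤ P := by
    rw [← hM, ← hP]
    exact subspaceMul_mono hDS hDS
  have hDM : ∀ d ∈ D, ∀ m ∈ M, d * m ∈ M ∧ m * d ∈ M := by
    subst hM
    exact fun d hd m hm => ⟨mul_mem_subspaceMul hd (hMD hm), mul_mem_subspaceMul (hMD hm) hd⟩
  have hMM : ∀ m ∈ M, ∀ m' ∈ M, m * m' = 0 := by
    intro m hm m' hm'
    have : m * m' ∈ C ⊓ D.toSubmodule :=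
      ⟨hC ▸ mul_mem_subspaceMul (hMP hm) (hMP hm'), D.mul_mem (hMD hm) (hMD hm')⟩
    rwa [hCD0, Submodule.mem_bot] at this
  obtain ⟨E, hED, hME, hME0⟩ := exists_isCompl_subalgebra helem D M hMD hDM
  have hEE : ∀ e ∈ E, ∀ e' ∈ E, e * e' = 0 := by
    intro e he e' he'
    have : e * e' ∈ M ⊓ E.toSubmodule :=
      ⟨hM ▸ mul_mem_subspaceMul (hED he) (hED he'), E.mul_mem he he'⟩
    rwa [hME0, Submodule.mem_bot] at this
  have hDMC : ∀ x ∈ D, ∀ y ∈ M, ∀ c ∈ C, x * y * c = 0 := fun x hx y hy =>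
    mul_mul_eq_zero helem hmulCC (hMM y hy y hy) (hMM _ (hDM x hx y hy).1 y hy)
      (fun c hc => (hSC x (hDS hx) c hc).1) (fun c hc => (hSC y (hDS (hMD hy)) c hc).1)
      (fun c hc => (hSC y (hDS (hMD hy)) c hc).2)
  -- Left multiplications by `x y` and by `y x` are negatives of each other.
  have hMDC : ∀ x ∈ D, ∀ y ∈ M, ∀ c ∈ C, y * x * c = 0 := by
    intro x hx y hy c hc
    have h1 := IsLeibniz.leibniz x y c
    rw [hDMC x hx y hy c hc, zero_add] at h1
    have h2 := IsLeibniz.leibniz y x c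
    rwa [h1, right_eq_add] at h2
  have hMC : ∀ m ∈ M, ∀ c ∈ C, m * c = 0 := by
    intro m hm c hc
    have hle : M ≤ LinearMap.ker (LinearMap.mulRight K c) := by
      rw [← hM, subspaceMul_le]
      intro d hd d' hd'
      obtain ⟨m, hm, e, he, rfl⟩ := Submodule.mem_sup.1 (hME ▸ hd)
      obtain ⟨m', hm', e', he', rfl⟩ := Submodule.mem_sup.1 (hME ▸ hd')
      change (m + e) * (m' + e') * c = 0
      rw [add_mul m e, mul_add, mul_add, hMM m hm m' hm', hEE e he e' he', zero_add, add_zero,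
        add_mul, hMDC e' (hED he') m hm c hc, hDMC e (hED he) m' hm' c hc, add_zero]
    exact hle hm
  have hCM : ∀ m ∈ M, ∀ c ∈ C, c * m = 0 := fun m hm =>
    mulRight_eq_zero_of_mulLeft_eq_zero helem hmulCC (hMM m hm m hm) (hMC m hm)
      (fun c hc => (hSC m (hDS (hMD hm)) c hc).2)
  have hPle : P ≤ C ⊔ M := by
    rw [← hP, subspaceMul_le]
    intro s hs t ht
    obtain ⟨c, hc, d, hd, rfl⟩ := Submodule.mem_sup.1 (hCD ▸ hs)
    obtain ⟨c', hc', d', hd', rfl⟩ := Submodule.mem_sup.1 (hCD ▸ ht)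
    rw [mul_add, add_mul c d d', ← add_assoc]
    exact Submodule.add_mem_sup
      (add_mem (hSC _ hs c' hc').1 (hSC d' (hDS hd') c hc).2)
      (hM ▸ mul_mem_subspaceMul hd hd')
  rw [eq_bot_iff, ← hC, subspaceMul_le]
  intro p hp q hq
  obtain ⟨c, hc, m, hm, rfl⟩ := Submodule.mem_sup.1 (hPle hp)
  obtain ⟨c', hc', m', hm', rfl⟩ := Submodule.mem_sup.1 (hPle hq)
  rw [Submodule.mem_bot, add_mul, mul_add, mul_add, hmulCC c hc c' hc', hCM m' hm' c hc,
    hMC m hm c' hc', hMM m hm m' hm', add_zero, add_zero]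

variable (K A) in
/-- The term `A⁽ⁿ⁾` of the derived series, as a subalgebra. -/
def derivedSubalgebra (n : ℕ) : NonUnitalSubalgebra K A :=
  { derivedSeries K A n with
    mul_mem' := by
      intro a b ha hb
      have hle : ∀ k, derivedSeries K A (k + 1) ≤ derivedSeries K A k := fun k => by
        induction k with
        | zero => exact le_top
        | succ k ih => exact subspaceMul_mono ih ih
      exact hle n (mul_mem_subspaceMul ha hb) }

theorem derivedSeries_two_eq_bot [PerfectField K] (hsolv : IsSolvable K A)
    (helem : IsElementary K A) : derivedSeries K A 2 = ⊥ := by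
  obtain ⟨n, hn⟩ := hsolv
  have hbot : derivedSeries K A (n + 2) = ⊥ := by
    rw [derivedSeries, derivedSeries, hn, eq_bot_iff]
    simp [subspaceMul]
  clear hn
  induction n with
  | zero => exact hbot
  | succ n ih =>
    exact ih (second_derived_eq_bot helem (derivedSubalgebra K A n)
      (P := derivedSeries K A (n + 1)) rfl rfl hbot)

end Derived

end Leibniz

theorem mainTheorem3 (K : Type*) (A : Type*) [Field K] [PerfectField K]
    [NonUnitalNonAssocRing A] [Module K A] [IsScalarTower K A A] [SMulCommClass K A A]
    [FiniteDimensional K A] [Leibniz.IsLeibniz A]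
    (hsolv : Leibniz.IsSolvable K A) (helem : Leibniz.IsElementary K A) :
    Leibniz.IsNilpotent K (Leibniz.square K A) := by
  refine ⟨1, ?_⟩
  rw [Leibniz.lowerCentralSeries, eq_bot_iff, Leibniz.subspaceMul_le]
  intro x _ y _
  have h : (x : A) * y ∈ Leibniz.derivedSeries K A 2 := Leibniz.mul_mem_subspaceMul x.2 y.2
  rw [Leibniz.derivedSeries_two_eq_bot hsolv helem, Submodule.mem_bot] at h
  exact (Submodule.mem_bot K).2 (Subtype.ext h)
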